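/- For non-zero polynomials $P_1,\dots,P_l\in\mathbb{C}[x]$ let \[m(P_1,\dots,P_l)=\frac{1}{2\pi i}\int_{|x|=1}\log|P_1(x)|\cdots\log|P_l(x)|\,\frac{dx}{x}\] be the multiple Mahler measure. Write $(\cdot,\cdot)$ for the greatest common divisor and $[\cdot,\cdot]$ for the least common multiple. For positive integers $d,m$ put $d_m=\frac{d}{(d,m)}$ and $m_d=\frac{m}{(d,m)}$, and let $[d_m^{-1}]_{m_d}$ be the unique integer $x$ with $0\le x\le m_d-1$ and $d_m x\equiv 1\pmod{m_d}$. Let $a,b,c$ be positive integers with $(a,b,c)=1$. Then the integral defining $m(x^a-1,x^b-1,x^c-1)$ and the six series below converge absolutely, and \begin{align*} -2m(x^a-1,x^b-1,x^c-1) ={}& abc\left(\frac{1}{[a,b]^3}+\frac{1}{[b,c]^3}+\frac{1}{[c,a]^3}\right)\zeta(3)\\ &-\frac{\pi}{2c(a,b)}\sum_{\substack{h\ge 1\\ b_a\nmid ch}}\frac{\cot\left(\pi\frac{[a_b^{-1}]_{b_a}ch}{b_a}\right)}{h^2} -\frac{\pi}{2b(a,c)}\sum_{\substack{h\ge 1\\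 c_a\nmid bh}}\frac{\cot\left(\pi\frac{[a_c^{-1}]_{c_a}bh}{c_a}\right)}{h^2}\\ &-\frac{\pi}{2a(b,c)}\sum_{\substack{h\ge 1\\ c_b\nmid ah}}\frac{\cot\left(\pi\frac{[b_c^{-1}]_{c_b}ah}{c_b}\right)}{h^2} -\frac{\pi}{2c(b,a)}\sum_{\substack{h\ge 1\\ a_b\nmid ch}}\frac{\cot\left(\pi\frac{[b_a^{-1}]_{a_b}ch}{a_b}\right)}{h^2}\\ &-\frac{\pi}{2b(c,a)}\sum_{\substack{h\ge 1\\ a_c\nmid bh}}\frac{\cot\left(\pi\frac{[c_a^{-1}]_{a_c}bh}{a_c}\right)}{h^2} -\frac{\pi}{2a(c,b)}\sum_{\substack{h\ge 1\\ b_c\nmid ah}}\frac{\cot\left(\pi\frac{[c_b^{-1}]_{b_c}ah}{b_c}\right)}{h^2}. \end{align*} -/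

import Mathlib

open Polynomial

/-- The integrand `x ↦ log |P₁(x)| ⋯ log |P_l(x)|` of the multiple Mahler measure. -/
noncomputable def mahlerIntegrand {l : ℕ} (P : Fin l → ℂ[X]) (x : ℂ) : ℝ :=
  ∏ i, Real.log ‖(P i).eval x‖

/-- The multiple Mahler measure
`m(P₁, …, P_l) = (2πi)⁻¹ ∫_{|x| = 1} log |P₁(x)| ⋯ log |P_l(x)| dx / x`,
that is, the average of the integrand over the unit circle. -/
noncomputable def multipleMahlerMeasure {l : ℕ} (P : Fin l → ℂ[X]) : ℝ :=
  Real.circleAverage (mahlerIntegrand P) 0 1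

/-- `redBy d m` is `d_m = d / (d, m)`. -/
def redBy (d m : ℕ) : ℕ := d / Nat.gcd d m

/-- `modSol d m n` is `[d_m⁻¹ n]_{m_d}`, the unique integer `x` with `0 ≤ x ≤ m_d - 1` and
`d_m x ≡ n (mod m_d)`; see `modSol_unique`. -/
def modSol (d m n : ℕ) : ℕ := ((redBy d m : ZMod (redBy m d))⁻¹ * (n : ZMod (redBy m d))).val

theorem modSol_unique (d m n : ℕ) (hm : 0 < m) (x : ℕ) :
    (x < redBy m d ∧ redBy d m * x ≡ n [MOD redBy m d]) ↔ x = modSol d m n := by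
  have hg : 0 < Nat.gcd m d := Nat.gcd_pos_of_pos_left d hm
  have hpos : 0 < redBy m d := Nat.div_pos (Nat.gcd_le_left d hm) hg
  have hco : Nat.Coprime (redBy d m) (redBy m d) := by
    have h := Nat.coprime_div_gcd_div_gcd (Nat.gcd_comm m d ▸ hg : 0 < Nat.gcd d m)
    unfold redBy
    rw [Nat.gcd_comm m d]
    exact h
  have hinv := ZMod.coe_mul_inv_eq_one (redBy d m) hco
  have : NeZero (redBy m d) := ⟨hpos.ne'⟩
  constructor
  · rintro ⟨hx, hmod⟩
    have h := (ZMod.natCast_eq_natCast_iff _ _ _).2 hmod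
    push_cast at h
    unfold modSol
    rw [← h, ← mul_assoc, mul_comm _ (redBy d m : ZMod (redBy m d)), hinv, one_mul,
      ZMod.val_cast_of_lt hx]
  · rintro rfl
    refine ⟨ZMod.val_lt _, (ZMod.natCast_eq_natCast_iff _ _ _).1 ?_⟩
    push_cast
    unfold modSol
    rw [ZMod.natCast_zmod_val, ← mul_assoc, hinv, one_mul]

/-- The `h`-th term `cot (π [d_m⁻¹]_{m_d} e h / m_d) / h²` of the series over the integers `h ≥ 1`
with `m_d ∤ e h`, extended by zero to all natural numbers `h`. -/
noncomputable def cotSeriesTerm (d m e h : ℕ) : ℝ :=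
  if 1 ≤ h ∧ ¬ redBy m d ∣ e * h then
    Real.cot (Real.pi * ((modSol d m 1 : ℝ) * e * h / redBy m d)) / (h : ℝ) ^ 2
  else 0

/-! On the unit circle, `-2 log |1 - y|` has the Fourier series `∑ yⁿ / |n|` over `n ≠ 0`.
Multiplying three such series and integrating turns `-8 m` into the sum of `1 / (|n| |m| |k|)` over
nonzero integer solutions of `a n + b m + c k = 0` (`hasSum_latticeTerm_one`). The series are not
absolutely convergent on the circle, so this is done at radius `r < 1` and `r` tends to `1`.

As `a, b, c > 0`, the numbers `n, m, k` never share a sign, and so `1 / (|n| |m| |k|)` is minus the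
sum of the three cyclic forms of `1 / (|n| m k)` (`inv_sum_abs`). Only one absolute value is left in
each.

Fix `n` in such a form. Solutions exist only for `n = (b, c) h`; they make up an arithmetic
progression in `t`, and the sum over it is a multiple of `∑ 1 / ((x + t) (y + t))`. Partial
fractions give a difference of cotangents at `π x` and `π y` (`tsum_int_inv_mul_inv`). If the
progression meets `m = 0` or `k = 0`, the omitted pole leaves a correction of order `1 / h²`.
Summing over `h` with weight `1 / |n|`, the cotangents give the six series and the corrections give
`ζ(3)` (`tsum_lattice`). -/

/-! ### Cotangent expansion and the sum of `1 / ((x + t) (y + t))` -/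

open Filter Topology in
theorem tendsto_sum_inv_add_inv_sub_int (m : ℤ) :
    Tendsto (fun N : ℕ => ∑ n ∈ Finset.range N, (1 / ((m : ℝ) + n) + 1 / ((m : ℝ) - n))) atTop
      (𝓝 (1 / (m : ℝ))) := by
  -- Replacing `x` by `x + 1` changes the symmetric sum only at its two ends and at the doubled term
  -- `n = 0`. The identity merely rearranges terms, so it survives `1 / 0 = 0`.
  have shift (x : ℝ) (N : ℕ) :
      ∑ n ∈ Finset.range N, (1 / ((x + 1) + n) + 1 / ((x + 1) - n)) =
        ∑ n ∈ Finset.range N, (1 / (x + n) + 1 / (x - n)) +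
          (1 / (x + N) - 1 / x + 1 / (x + 1) - 1 / (x + 1 - N)) := by
    induction N with
    | zero => simp
    | succ N ih =>
      rw [Finset.sum_range_succ, Finset.sum_range_succ, ih]
      push_cast
      rw [show x + 1 - ((N : ℝ) + 1) = x - N by ring, show x + 1 + (N : ℝ) = x + (N + 1) by ring]
      ring
  have lim1 (x : ℝ) : Tendsto (fun N : ℕ => 1 / (x + N)) atTop (𝓝 0) := by
    simp only [one_div]
    exact tendsto_inv_atTop_zero.comp
      (tendsto_atTop_add_const_left _ _ tendsto_natCast_atTop_atTop)
  have lim2 (x : ℝ) : Tendsto (fun N : ℕ => 1 / (x - N)) atTop (𝓝 0) := by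
    have := (lim1 (-x)).neg
    simp only [neg_zero] at this
    refine this.congr fun N => ?_
    rw [show x - (N : ℝ) = -(-x + N) by ring, div_neg]
  have lim (x : ℝ) : Tendsto (fun N : ℕ => 1 / (x + N) - 1 / x + 1 / (x + 1) - 1 / (x + 1 - N))
      atTop (𝓝 (1 / (x + 1) - 1 / x)) := by
    have := (((lim1 x).sub_const (1 / x)).add_const (1 / (x + 1))).sub (lim2 (x + 1))
    convert this using 2
    ring
  induction m using Int.induction_on with
  | zero => simp
  | succ m ih =>
    push_cast at ih ⊢
    simp_rw [shift]
    convert ih.add (lim m) using 2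
    ring
  | pred m ih =>
    push_cast at ih ⊢
    have h := lim (-m - 1)
    have h2 := ih.sub h
    convert h2 using 2
    · rename_i N
      have := shift (-m - 1) N
      simp only [sub_add_cancel] at this ⊢
      rw [this]
      ring
    · ring

open Filter Topology in
/-- The principal value expansion of the cotangent, valid at integers too when division by zero is
read as zero. -/
theorem tendsto_sum_inv_add_inv_sub (x : ℝ) :
    Tendsto (fun N : ℕ => ∑ n ∈ Finset.range N, (1 / (x + n) + 1 / (x - n))) atTop
      (𝓝 (Real.pi * Real.cot (Real.pi * x) + 1 / x)) := by
  by_cases hx : ∃ m : ℤ, (m : ℝ) = x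
  · obtain ⟨m, rfl⟩ := hx
    have : Real.cot (Real.pi * m) = 0 := by
      rw [Real.cot_eq_cos_div_sin, mul_comm, Real.sin_int_mul_pi, div_zero]
    simpa [this] using tendsto_sum_inv_add_inv_sub_int m
  · have hz : (x : ℂ) ∈ Complex.integerComplement := by
      rintro ⟨m, hm⟩
      exact hx ⟨m, by exact_mod_cast hm⟩
    have h1 := cot_series_rep' hz
    have h2 := (summable_cotTerm hz).hasSum
    simp only [cotTerm] at h2
    rw [← h1] at h2
    have h3 : HasSum (fun n : ℕ => 1 / (x - (n + 1)) + 1 / (x + (n + 1)))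
        (Real.pi * Real.cot (Real.pi * x) - 1 / x) := by
      rw [← Complex.hasSum_ofReal]
      push_cast
      exact h2
    -- The index `n = 0` contributes `1 / x` twice, hence the extra `1 / x` in the limit.
    have h4 := (h3.tendsto_sum_nat).add_const (1 / x + 1 / x)
    rw [← tendsto_add_atTop_iff_nat 1]
    simp_rw [Finset.sum_range_succ']
    convert h4 using 2
    · push_cast
      rw [add_zero, sub_zero]
      congr 1
      exact Finset.sum_congr rfl fun n _ => add_comm _ _
    · ring

open Filter Topology in
theorem summable_int_inv_mul_inv (x y : ℝ) :
    Summable fun t : ℤ => 1 / ((x + t) * (y + t)) := by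
  have h (x : ℝ) : Summable fun t : ℤ => 1 / |x + t| ^ 2 := by
    have := (Real.summable_one_div_int_add_rpow x 2).2 (by norm_num)
    refine this.congr fun t => ?_
    rw [add_comm, Real.rpow_two]
  refine Summable.of_norm_bounded ((h x).add (h y)) fun t => ?_
  rw [norm_div, norm_mul, norm_one, Real.norm_eq_abs, Real.norm_eq_abs]
  simp only [one_div, mul_inv, ← inv_pow]
  have h1 : 0 ≤ |x + t|⁻¹ := by positivity
  have h2 : 0 ≤ |y + t|⁻¹ := by positivity
  nlinarith [sq_nonneg (|x + t|⁻¹ - |y + t|⁻¹), sq_nonneg (|x + t|⁻¹ + |y + t|⁻¹)]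

open Classical in
theorem hasSum_int_add_eq_zero (x v : ℝ) :
    HasSum (fun t : ℤ => if x + t = 0 then v else 0)
      (if ∃ m : ℤ, (m : ℝ) = x then v else 0) := by
  split_ifs with h
  · obtain ⟨m, rfl⟩ := h
    convert hasSum_ite_eq (-m) v using 2 with t
    have : (m : ℝ) + t = 0 ↔ t = -m := by
      rw [add_comm, add_eq_zero_iff_eq_neg]
      norm_cast
    simp only [this]
  · convert hasSum_zero with t
    rw [if_neg]
    intro ht
    exact h ⟨-t, by push_cast; linarith⟩

-- Partial fractions, with a term corrected where `x + t` or `y + t` vanishes: there the left side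
-- is `0`, while the difference of fractions over `y - x` is `-1 / (y - x) ^ 2`.
open Filter Topology Classical in
theorem tsum_int_inv_mul_inv {x y : ℝ} (hxy : x ≠ y) :
    ∑' t : ℤ, 1 / ((x + t) * (y + t)) =
      (Real.pi * Real.cot (Real.pi * x) - Real.pi * Real.cot (Real.pi * y)) / (y - x) +
        ((if ∃ m : ℤ, (m : ℝ) = x then 1 / (y - x) ^ 2 else 0) +
          (if ∃ m : ℤ, (m : ℝ) = y then 1 / (y - x) ^ 2 else 0)) := by
  have hyx : y - x ≠ 0 := sub_ne_zero.2 hxy.symm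
  have key (t : ℤ) : 1 / ((x + t) * (y + t)) - ((if x + t = 0 then 1 / (y - x) ^ 2 else 0) +
      (if y + t = 0 then 1 / (y - x) ^ 2 else 0)) = (1 / (x + t) - 1 / (y + t)) / (y - x) := by
    by_cases h1 : x + t = 0
    · have h2 : y + t = y - x := by linarith
      rw [h2, h1]
      simp only [hyx, if_true, if_false]
      field_simp
      simp
    by_cases h2 : y + t = 0
    · have h3 : x + t = -(y - x) := by linarith
      rw [h2, h3]
      simp only [neg_eq_zero, hyx, if_true, if_false]
      field_simp
      simp
    · simp only [h1, h2, if_false]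
      field_simp
      ring
  have hs := (summable_int_inv_mul_inv x y).hasSum.sub
    ((hasSum_int_add_eq_zero x (1 / (y - x) ^ 2)).add
      (hasSum_int_add_eq_zero y (1 / (y - x) ^ 2)))
  simp_rw [key] at hs
  -- The two cotangent expansions converge only as principal values, so `t` is paired with `-t`. The
  -- doubled `t = 0` matches the doubled term in those limits.
  have h1 := hs.nat_add_neg.tendsto_sum_nat
  have h2 := ((tendsto_sum_inv_add_inv_sub x).sub (tendsto_sum_inv_add_inv_sub y)).div_const
    (y - x)
  have h3 := tendsto_nhds_unique h1 (h2.congr fun N => by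
    rw [← Finset.sum_sub_distrib, Finset.sum_div]
    refine Finset.sum_congr rfl fun n _ => ?_
    push_cast
    rw [← sub_eq_add_neg, ← sub_eq_add_neg]
    ring)
  push_cast at h3
  simp only [add_zero] at h3
  rw [← sub_eq_iff_eq_add]
  linear_combination h3

/-! ### Cotangents modulo one and the cotangent series -/

theorem Real.cot_add_int_mul_pi (x : ℝ) (k : ℤ) : Real.cot (x + k * Real.pi) = Real.cot x := by
  have h : ((-1 : ℝ) ^ k) ≠ 0 := zpow_ne_zero _ (by norm_num)
  rw [Real.cot_eq_cos_div_sin, Real.cot_eq_cos_div_sin, Real.cos_add_int_mul_pi,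
    Real.sin_add_int_mul_pi, mul_div_mul_left _ _ h]

theorem Real.cot_neg' (x : ℝ) : Real.cot (-x) = -Real.cot x := by
  rw [Real.cot_eq_cos_div_sin, Real.cot_eq_cos_div_sin, Real.cos_neg, Real.sin_neg, div_neg]

/-- `Real.cot (π x)` depends only on the class of `x` modulo one. -/
theorem Real.cot_pi_mul_congr {x y : ℝ} (k : ℤ) (h : x = y + k) :
    Real.cot (Real.pi * x) = Real.cot (Real.pi * y) := by
  rw [h, mul_add, mul_comm Real.pi (k : ℝ), Real.cot_add_int_mul_pi]

theorem redBy_pos {d : ℕ} (m : ℕ) (hd : 0 < d) : 0 < redBy d m :=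
  Nat.div_pos (Nat.gcd_le_left m hd) (Nat.gcd_pos_of_pos_left m hd)

theorem gcd_mul_redBy (d m : ℕ) : Nat.gcd d m * redBy d m = d :=
  Nat.mul_div_cancel' (Nat.gcd_dvd_left d m)

theorem coprime_redBy {d m : ℕ} (hd : 0 < d) : Nat.Coprime (redBy d m) (redBy m d) := by
  unfold redBy
  rw [Nat.gcd_comm m d]
  exact Nat.coprime_div_gcd_div_gcd (Nat.gcd_pos_of_pos_left m hd)

theorem redBy_mul_modSol_one (d : ℕ) {m : ℕ} (hm : 0 < m) :
    (redBy m d : ℤ) ∣ redBy d m * modSol d m 1 - 1 := by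
  have h := ((modSol_unique d m 1 hm _).2 rfl).2
  have := (Nat.modEq_iff_dvd.1 h.symm)
  push_cast at this
  exact this

/-- The cotangent is periodic in `h`, so it takes finitely many values and the series is dominated
by a multiple of `∑ 1 / h²`. -/
theorem summable_cotSeriesTerm (d e : ℕ) {m : ℕ} (hm : 0 < m) :
    Summable (cotSeriesTerm d m e) := by
  set N := redBy m d with hN
  have hNpos : 0 < N := redBy_pos d hm
  have hN0 : (N : ℝ) ≠ 0 := by positivity
  set f : ℕ → ℝ := fun h => Real.cot (Real.pi * ((modSol d m 1 : ℝ) * e * h / N)) with hf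
  have hper (h : ℕ) : f h = f (h % N) := by
    refine Real.cot_pi_mul_congr ((modSol d m 1 * e * (h / N) : ℕ) : ℤ) ?_
    have : (h : ℝ) = (h % N : ℕ) + N * (h / N : ℕ) := by exact_mod_cast (Nat.mod_add_div h N).symm
    rw [this]
    simp only [Int.cast_natCast]
    push_cast [-Nat.cast_div_charZero]
    field_simp
  have hbd (h : ℕ) : |f h| ≤ ∑ r ∈ Finset.range N, |f r| := by
    rw [hper]
    exact Finset.single_le_sum (f := fun r => |f r|) (fun r _ => abs_nonneg _)
      (Finset.mem_range.2 (Nat.mod_lt h hNpos))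
  refine Summable.of_norm_bounded
    ((Real.summable_one_div_nat_pow.2 one_lt_two).mul_left (∑ r ∈ Finset.range N, |f r|))
    fun h => ?_
  unfold cotSeriesTerm
  split_ifs
  · rw [norm_div, mul_one_div, norm_pow, RCLike.norm_natCast]
    gcongr
    exact hbd h
  · rw [norm_zero]
    have := (abs_nonneg _).trans (hbd h)
    positivity

/-- The side condition is redundant: the excluded terms vanish because `Real.cot` is `0` at
multiples of `π` and division by zero gives `0`. -/
theorem cotSeriesTerm_eq {d m : ℕ} (e h : ℕ) (hm : 0 < m) :
    cotSeriesTerm d m e h =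
      Real.cot (Real.pi * ((modSol d m 1 : ℝ) * e * h / redBy m d)) / (h : ℝ) ^ 2 := by
  unfold cotSeriesTerm
  split_ifs with H
  · rfl
  · rcases Nat.eq_zero_or_pos h with rfl | hh
    · simp
    · have : redBy m d ∣ e * h := by
        by_contra h'
        exact H ⟨hh, h'⟩
      obtain ⟨k, hk⟩ := this
      have hN0 : (redBy m d : ℝ) ≠ 0 := by
        have := redBy_pos d hm
        positivity
      have hk' : (e : ℝ) * h = redBy m d * k := by exact_mod_cast hk
      rw [Real.cot_pi_mul_congr (y := 0) ((modSol d m 1 * k : ℕ) : ℤ)]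
      · simp [Real.cot_eq_cos_div_sin]
      · rw [mul_assoc, hk']
        push_cast
        field_simp
        ring

/-! ### The lattice sum with one absolute value -/

/-- The sum of `1 / (m k)` over the solutions of `a n + b m + c k = 0` with `m, k ≠ 0`. -/
noncomputable def planeSum (a b c : ℕ) (n : ℤ) : ℝ :=
  ∑' p : ℤ × ℤ, if a * n + b * p.1 + c * p.2 = 0 then 1 / ((p.1 : ℝ) * p.2) else 0

theorem planeSum_neg (a b c : ℕ) (n : ℤ) : planeSum a b c (-n) = planeSum a b c n := by
  unfold planeSum
  rw [← (Equiv.neg (ℤ × ℤ)).tsum_eq]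
  refine tsum_congr fun p => ?_
  have : a * -n + b * (-p.1) + c * (-p.2) = 0 ↔ a * n + b * p.1 + c * p.2 = 0 := by
    constructor <;> intro h <;> linarith
  simp only [Equiv.neg_apply, Prod.fst_neg, Prod.snd_neg, this, Int.cast_neg, neg_mul_neg]

theorem planeSum_eq_zero {a b c : ℕ} (habc : Nat.gcd (Nat.gcd a b) c = 1) {n : ℤ}
    (hn : ¬ (Nat.gcd b c : ℤ) ∣ n) : planeSum a b c n = 0 := by
  unfold planeSum
  refine (tsum_congr fun p => if_neg fun h => hn ?_).trans tsum_zero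
  have h1 : (Nat.gcd b c : ℤ) ∣ a * n := by
    have hb : (Nat.gcd b c : ℤ) ∣ b := by exact_mod_cast Nat.gcd_dvd_left b c
    have hc : (Nat.gcd b c : ℤ) ∣ c := by exact_mod_cast Nat.gcd_dvd_right b c
    rw [show (a : ℤ) * n = -(b * p.1 + c * p.2) by linarith]
    exact ((hb.mul_right _).add (hc.mul_right _)).neg_right
  refine IsCoprime.dvd_of_dvd_mul_left (Nat.isCoprime_iff_coprime.2 ?_) h1
  rw [Nat.Coprime, Nat.gcd_comm, ← Nat.gcd_assoc, habc]

theorem planeSum_gcd_mul {a b c : ℕ} (ha : 0 < a) (hb : 0 < b) (hc : 0 < c)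
    {h : ℕ} (hh : 0 < h) :
    planeSum a b c (Nat.gcd b c * h : ℕ) =
      Real.pi * h / a * (cotSeriesTerm b c a h + cotSeriesTerm c b a h) -
      redBy b c * redBy c b / (a * h : ℝ) ^ 2 *
        ((if redBy c b ∣ a * h then 1 else 0) + (if redBy b c ∣ a * h then 1 else 0)) := by
  have hBpos := redBy_pos c hb
  have hCpos := redBy_pos b hc
  have hcop : IsCoprime (redBy b c : ℤ) (redBy c b) :=
    Nat.isCoprime_iff_coprime.2 (coprime_redBy hb)
  have hgB := gcd_mul_redBy b c
  have hgC := gcd_mul_redBy c b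
  have hs := redBy_mul_modSol_one b hc
  have hs' := redBy_mul_modSol_one c hb
  have hg : 0 < Nat.gcd b c := Nat.gcd_pos_of_pos_left c hb
  rw [Nat.gcd_comm] at hgC
  rw [cotSeriesTerm_eq a h hb, cotSeriesTerm_eq a h hc]
  unfold planeSum
  generalize modSol b c 1 = s at *
  generalize modSol c b 1 = s' at *
  generalize redBy b c = B at *
  generalize redBy c b = C at *
  generalize Nat.gcd b c = g at *
  subst hgB hgC
  obtain ⟨w, hw⟩ := hs
  have hbez : (B : ℤ) * s - C * w = 1 := by linarith
  have hB0 : (B : ℝ) ≠ 0 := by positivity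
  have hC0 : (C : ℝ) ≠ 0 := by positivity
  have ha0 : (a : ℝ) ≠ 0 := by positivity
  have hh0 : (h : ℝ) ≠ 0 := by positivity
  have hbezR : (B : ℝ) * s - C * w = 1 := by exact_mod_cast hbez
  -- After division by `g` the equation is `B m + C k = -a h`; the Bézout relation supplies the
  -- particular solution at `t = 0`.
  have hinj : Function.Injective fun t : ℤ => ((-(s * a * h) + C * t, a * h * w - B * t) : ℤ × ℤ) := by
    intro t t' htt
    have := congrArg Prod.fst htt
    simp only [add_right_inj] at this
    exact mul_left_cancel₀ (by exact_mod_cast hCpos.ne') this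
  rw [← hinj.tsum_eq]
  swap
  · intro p hp
    simp only [Function.mem_support, ne_eq, ite_eq_right_iff, Classical.not_imp] at hp
    have h1 : (a : ℤ) * h + B * p.1 + C * p.2 = 0 := by
      have := hp.1
      push_cast at this
      refine mul_left_cancel₀ (show (g : ℤ) ≠ 0 by exact_mod_cast hg.ne') ?_
      linear_combination this
    have h2 : B * (p.1 + s * a * h) = C * (a * h * w - p.2) := by
      linear_combination h1 + a * h * hbez
    obtain ⟨t, ht⟩ := hcop.symm.dvd_of_dvd_mul_left ⟨_, h2⟩
    refine ⟨t, Prod.ext ?_ ?_⟩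
    · simp only
      linarith
    · simp only
      rw [ht] at h2
      refine mul_left_cancel₀ (show (C : ℤ) ≠ 0 by exact_mod_cast hCpos.ne') ?_
      linear_combination -h2
  set x : ℝ := -(s * a * h) / C with hx
  set y : ℝ := -(a * h * w) / B with hy
  have hyx : y - x = a * h / (B * C) := by
    rw [hx, hy]
    field_simp
    linear_combination hbezR
  have hne : x ≠ y := by
    intro hxy
    rw [hxy, sub_self] at hyx
    have : (a : ℝ) * h / (B * C) ≠ 0 := by positivity
    exact this hyx.symm
  have hterm (t : ℤ) : (if (a : ℤ) * (g * h : ℕ) + (g * B : ℕ) * (-(s * a * h) + C * t)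
      + (g * C : ℕ) * (a * h * w - B * t) = 0 then
      1 / (((-(s * a * h) + C * t : ℤ) : ℝ) * ((a * h * w - B * t : ℤ) : ℝ)) else 0) =
      -1 / (B * C) * (1 / ((x + t) * (y + t))) := by
    rw [if_pos]
    · have e1 : ((-(s * a * h) + C * t : ℤ) : ℝ) = C * (x + t) := by
        rw [hx]
        push_cast
        field_simp
      have e2 : ((a * h * w - B * t : ℤ) : ℝ) = -B * (y + t) := by
        rw [hy]
        push_cast
        field_simp
        ring
      rw [e1, e2, show (C : ℝ) * (x + t) * (-B * (y + t)) = -((B * C) * ((x + t) * (y + t))) by ring,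
        div_neg, one_div, mul_inv, one_div]
      ring
    · push_cast
      linear_combination -(g * a * h : ℤ) * hbez
  rw [tsum_congr hterm, tsum_mul_left, tsum_int_inv_mul_inv hne, hyx]
  have hcx : Real.cot (Real.pi * x) = -Real.cot (Real.pi * (s * a * h / C)) := by
    rw [← Real.cot_neg', hx]
    congr 1
    ring
  -- Modulo `B` the Bézout relation reads `C w ≡ -1`, so `w ≡ -s'`.
  have hcy : Real.cot (Real.pi * y) = Real.cot (Real.pi * (s' * a * h / B)) := by
    have : (B : ℤ) ∣ s' + w := by
      refine hcop.dvd_of_dvd_mul_left (y := (C : ℤ)) ?_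
      have : (C : ℤ) * (s' + w) = (C * s' - 1) + B * s := by linarith
      rw [this]
      exact hs'.add (dvd_mul_right _ _)
    obtain ⟨q, hq⟩ := this
    have hqR : (s' : ℝ) + w = B * q := by exact_mod_cast hq
    refine Real.cot_pi_mul_congr (-(a * h * q)) ?_
    rw [hy]
    push_cast
    field_simp
    linear_combination -hqR
  -- Integrality of `x` means that the progression meets `m = 0`; `s` is invertible modulo `C` and
  -- drops out.
  have hix : (∃ m : ℤ, (m : ℝ) = x) ↔ C ∣ a * h := by
    rw [← Int.natCast_dvd_natCast]
    have hcs : IsCoprime (C : ℤ) s := ⟨-w, B, by linarith⟩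
    constructor
    · rintro ⟨m, hm⟩
      refine hcs.dvd_of_dvd_mul_left ⟨-m, ?_⟩
      rw [hx, eq_div_iff hC0] at hm
      have : m * C = -(s * a * h : ℤ) := by exact_mod_cast hm
      push_cast
      linarith
    · rintro ⟨k, hk⟩
      refine ⟨-(s * k), ?_⟩
      have : (a : ℝ) * h = C * k := by exact_mod_cast hk
      rw [hx, mul_assoc, this]
      push_cast
      field_simp
  have hiy : (∃ m : ℤ, (m : ℝ) = y) ↔ B ∣ a * h := by
    rw [← Int.natCast_dvd_natCast]
    have hcs : IsCoprime (B : ℤ) w := ⟨s, -C, by linarith⟩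
    constructor
    · rintro ⟨m, hm⟩
      refine hcs.dvd_of_dvd_mul_right ⟨-m, ?_⟩
      rw [hy, eq_div_iff hB0] at hm
      have : m * B = -(a * h * w : ℤ) := by exact_mod_cast hm
      push_cast
      linarith
    · rintro ⟨k, hk⟩
      refine ⟨-(w * k), ?_⟩
      have : (a : ℝ) * h = B * k := by exact_mod_cast hk
      rw [hy, this]
      push_cast
      field_simp
  simp only [hix, hiy, hcx, hcy]
  split_ifs <;> field_simp <;> ring

/-- Multiplied by `g`, the condition says that both `a` and `c` divide `a g h`, that is, `[a, c]`
does. So `h` runs over the multiples of `[a, c] / (a g)`. -/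
theorem hasSum_dvd_div_pow_three {a c g C : ℕ} (ha : 0 < a) (hg : 0 < g) (hc : 0 < c)
    (hgc : g * C = c) (hag : Nat.Coprime a g) :
    HasSum (fun h : ℕ => (if C ∣ a * h then (1 : ℝ) else 0) / (h : ℝ) ^ 3)
      ((a * g : ℝ) ^ 3 / (Nat.lcm a c : ℝ) ^ 3 * ∑' n : ℕ, 1 / (n : ℝ) ^ 3) := by
  obtain ⟨q, hq⟩ : a * g ∣ Nat.lcm a c :=
    hag.mul_dvd_of_dvd_of_dvd (Nat.dvd_lcm_left a c)
      ((Dvd.intro _ hgc).trans (Nat.dvd_lcm_right a c))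
  have hiff (h : ℕ) : C ∣ a * h ↔ q ∣ h := by
    rw [← Nat.mul_dvd_mul_iff_left (Nat.mul_pos ha hg) (b := q), ← hq, Nat.lcm_dvd_iff,
      ← Nat.mul_dvd_mul_iff_left hg, hgc, show g * (a * h) = a * g * h by ring]
    exact ⟨fun H => ⟨⟨g * h, mul_assoc _ _ _⟩, H⟩, fun H => H.2⟩
  have hq0 : 0 < q := by
    rcases Nat.eq_zero_or_pos q with rfl | hq0
    · exact absurd hq (Nat.lcm_pos ha hc).ne'
    · exact hq0
  have hinj : Function.Injective fun n : ℕ => q * n := fun x y hxy =>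
    Nat.eq_of_mul_eq_mul_left hq0 hxy
  simp only [hiff]
  rw [← hinj.hasSum_iff]
  · have hs := ((Real.summable_one_div_nat_pow.2 (show 1 < 3 by norm_num)).hasSum).mul_left
      ((a * g : ℝ) ^ 3 / (Nat.lcm a c : ℝ) ^ 3)
    refine Eq.subst (motive := fun f => HasSum f _) (funext fun n => ?_) hs
    rw [hq]
    have : (a : ℝ) ≠ 0 := by positivity
    have : (g : ℝ) ≠ 0 := by positivity
    have : (q : ℝ) ≠ 0 := by positivity
    simp only [Function.comp, dvd_mul_right, if_true]
    push_cast
    field_simp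
  · intro h hh
    rw [if_neg, zero_div]
    rintro ⟨k, rfl⟩
    exact hh ⟨k, rfl⟩

/-- The sum of `1 / (|n| m k)` over the solutions of `a n + b m + c k = 0` with `n, m, k ≠ 0`. -/
theorem tsum_lattice {a b c : ℕ} (ha : 0 < a) (hb : 0 < b) (hc : 0 < c)
    (habc : Nat.gcd (Nat.gcd a b) c = 1) {S : ℝ}
    (hS : HasSum (fun p : ℤ × ℤ × ℤ => if a * p.1 + b * p.2.1 + c * p.2.2 = 0 then
      1 / (|(p.1 : ℝ)| * p.2.1 * p.2.2) else 0) S) :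
    S = 2 * Real.pi / (a * Nat.gcd b c) *
        (∑' h : ℕ, cotSeriesTerm b c a h + ∑' h : ℕ, cotSeriesTerm c b a h) -
      2 * (a * b * c) * (1 / (Nat.lcm a c : ℝ) ^ 3 + 1 / (Nat.lcm a b : ℝ) ^ 3) *
        ∑' n : ℕ, 1 / (n : ℝ) ^ 3 := by
  have hg : 0 < Nat.gcd b c := Nat.gcd_pos_of_pos_left c hb
  have hag : Nat.Coprime a (Nat.gcd b c) := by rw [Nat.Coprime, ← Nat.gcd_assoc, habc]
  have hS1 : HasSum (fun n : ℤ => 1 / |(n : ℝ)| * planeSum a b c n) S := by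
    have := hS.prod_fiberwise (g := fun n : ℤ => 1 / |(n : ℝ)| * planeSum a b c n) fun n => by
      have h1 := (hS.summable.prod_factor n).hasSum
      rw [show 1 / |(n : ℝ)| * planeSum a b c n = _ from ?_]
      · exact h1
      unfold planeSum
      rw [← tsum_mul_left]
      refine tsum_congr fun p => ?_
      simp only [mul_ite, mul_zero]
      congr 1
      rw [div_mul_div_comm, one_mul, mul_assoc]
    exact this
  -- `planeSum` is even in `n`, which gives the factor `2`; the `n = 0` term is `0` since `1 / 0 =
  -- 0`.
  have hS2 := hS1.nat_add_neg
  simp only [planeSum_neg, Int.cast_neg, abs_neg, Int.cast_zero, abs_zero, div_zero, zero_mul,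
    add_zero, Int.cast_natCast, Nat.abs_cast] at hS2
  have hinj : Function.Injective fun n : ℕ => Nat.gcd b c * n := fun x y hxy =>
    Nat.eq_of_mul_eq_mul_left hg hxy
  rw [← hinj.hasSum_iff] at hS2
  swap
  · intro n hn
    rw [planeSum_eq_zero habc, mul_zero, add_zero]
    rintro h
    obtain ⟨k, hk⟩ := Int.natCast_dvd_natCast.1 h
    exact hn ⟨k, hk.symm⟩
  have h1 := ((summable_cotSeriesTerm b a hc).hasSum.add
    (summable_cotSeriesTerm c a hb).hasSum).mul_left (2 * Real.pi / (a * Nat.gcd b c))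
  have h2 := ((hasSum_dvd_div_pow_three ha hg hc (by rw [Nat.gcd_comm, gcd_mul_redBy]) hag
    (C := redBy c b)).add (hasSum_dvd_div_pow_three ha hg hb (gcd_mul_redBy b c) hag)).mul_left
      (2 * (redBy b c * redBy c b : ℝ) / (Nat.gcd b c * a ^ 2))
  have h3 := hS2.unique
    (Eq.subst (motive := fun f => HasSum f _) (funext fun h => ?_) (h1.sub h2))
  · rw [h3]
    have e1 : (b : ℝ) = Nat.gcd b c * redBy b c := by exact_mod_cast (gcd_mul_redBy b c).symm
    have e2 : (c : ℝ) = Nat.gcd b c * redBy c b := by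
      have := gcd_mul_redBy c b
      rw [Nat.gcd_comm] at this
      exact_mod_cast this.symm
    have hg0 : (Nat.gcd b c : ℝ) ≠ 0 := by positivity
    have ha0 : (a : ℝ) ≠ 0 := by positivity
    have hl1 : (Nat.lcm a c : ℝ) ≠ 0 := by exact_mod_cast (Nat.lcm_pos ha hc).ne'
    have hl2 : (Nat.lcm a b : ℝ) ≠ 0 := by exact_mod_cast (Nat.lcm_pos ha hb).ne'
    have e3 : 2 * ((a : ℝ) * b * c) =
        2 * (redBy b c * redBy c b) / (Nat.gcd b c * a ^ 2) * (a * Nat.gcd b c) ^ 3 := by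
      rw [mul_assoc (a : ℝ), show (b : ℝ) * c = _ from congrArg₂ (· * ·) e1 e2]
      field_simp
    rw [e3]
    ring
  · simp only [Function.comp]
    rcases Nat.eq_zero_or_pos h with rfl | hh
    · simp [cotSeriesTerm]
    · rw [planeSum_gcd_mul ha hb hc hh]
      have hh0 : (h : ℝ) ≠ 0 := by positivity
      have ha0 : (a : ℝ) ≠ 0 := by positivity
      have hg0 : (Nat.gcd b c : ℝ) ≠ 0 := by positivity
      push_cast
      field_simp
      ring

/-! ### Fourier expansion at radius `r < 1` -/

theorem circleMap_zero_one_pow (θ : ℝ) (a : ℕ) : circleMap 0 1 θ ^ a = circleMap 0 1 (a * θ) := by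
  simp only [circleMap_zero, Complex.ofReal_one, one_mul, ← Complex.exp_nat_mul]
  congr 1
  push_cast
  ring

theorem norm_circleMap_zero_one (θ : ℝ) : ‖circleMap 0 1 θ‖ = 1 := by simp

/-- The coefficients of the Fourier series of `-2 log |1 - r e^{iθ}|`. -/
noncomputable def logCoeff (r : ℝ) (n : ℤ) : ℝ := r ^ n.natAbs / |(n : ℝ)|

theorem logCoeff_nonneg {r : ℝ} (hr : 0 ≤ r) (n : ℤ) : 0 ≤ logCoeff r n := by
  unfold logCoeff
  positivity

theorem logCoeff_le_one {r : ℝ} (hr : 0 ≤ r) (hr1 : r ≤ 1) (n : ℤ) :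
    logCoeff r n ≤ logCoeff 1 n := by
  unfold logCoeff
  rw [one_pow]
  gcongr
  exact pow_le_one₀ hr hr1

theorem summable_logCoeff {r : ℝ} (hr : 0 ≤ r) (hr1 : r < 1) : Summable (logCoeff r) := by
  have h : Summable fun n : ℕ => r ^ n / (n : ℝ) := by
    refine Summable.of_nonneg_of_le (fun n => by positivity) (fun n => ?_)
      (summable_geometric_of_lt_one hr hr1)
    rcases Nat.eq_zero_or_pos n with rfl | hn
    · simp
    · exact div_le_self (by positivity) (by exact_mod_cast hn)
  refine Summable.of_nat_of_neg (h.congr fun n => ?_) (h.congr fun n => ?_) <;> simp [logCoeff]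

/-- The Taylor series of `-log (1 - z)` gives the positive frequencies and its conjugate the
negative ones, as `y⁻¹` is the conjugate of `y`. -/
theorem hasSum_logCoeff_mul_zpow {r : ℝ} (hr : 0 ≤ r) (hr1 : r < 1) {y : ℂ} (hy : ‖y‖ = 1) :
    HasSum (fun n : ℤ => (logCoeff r n : ℂ) * y ^ n) ((-2 * Real.log ‖1 - r * y‖ : ℝ) : ℂ) := by
  have hz : ‖(r : ℂ) * y‖ < 1 := by
    rw [norm_mul, hy, mul_one, Complex.norm_real, Real.norm_eq_abs, abs_of_nonneg hr]
    exact hr1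
  have h1 := Complex.hasSum_taylorSeries_neg_log hz
  have h2 := (Complex.hasSum_conj' ).2 h1
  have h3 := HasSum.of_nat_of_neg (f := fun n : ℤ => (logCoeff r n : ℂ) * y ^ n)
    (g := -Complex.log (1 - r * y)) (g' := (starRingEnd ℂ) (-Complex.log (1 - r * y)))
    (by
      refine Eq.subst (motive := fun f => HasSum f _) (funext fun n => ?_) h1
      simp [logCoeff, mul_pow]
      ring)
    (by
      refine Eq.subst (motive := fun f => HasSum f _) (funext fun n => ?_) h2
      have : (starRingEnd ℂ) y = y⁻¹ := by
        rw [Complex.inv_def, Complex.normSq_eq_norm_sq, hy]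
        simp
      simp [logCoeff, mul_pow, this]
      ring)
  rw [Complex.add_conj, Complex.neg_re, Complex.log_re] at h3
  have h4 : ((-2 * Real.log ‖1 - r * y‖ : ℝ) : ℂ) =
      ((2 * -Real.log ‖1 - r * y‖ : ℝ) : ℂ) - (logCoeff r 0 : ℂ) * y ^ (0 : ℤ) := by
    simp [logCoeff]
  rw [h4]
  exact h3

theorem integral_circleMap_zpow (k : ℤ) :
    ∫ θ in 0..2 * Real.pi, circleMap 0 1 θ ^ k = if k = 0 then 2 * (Real.pi : ℂ) else 0 := by
  split_ifs with hk
  · simp [hk]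
  · have h (θ : ℝ) : circleMap 0 1 θ ^ k = Complex.exp ((k * Complex.I) * θ) := by
      rw [circleMap_zero, Complex.ofReal_one, one_mul, ← Complex.exp_int_mul]
      congr 1
      ring
    simp_rw [h]
    rw [integral_exp_mul_complex (by simp [hk])]
    have : Complex.exp (k * Complex.I * (2 * Real.pi : ℝ)) = 1 := by
      rw [Complex.exp_eq_one_iff]
      exact ⟨k, by push_cast; ring⟩
    rw [this]
    simp

/-- `log |1 - r e^{iaθ}|`. -/
noncomputable def radialLog (r : ℝ) (a : ℕ) (θ : ℝ) : ℝ :=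
  Real.log ‖1 - r * circleMap 0 1 θ ^ a‖

theorem continuous_circleMap_zero_one : Continuous fun θ : ℝ => circleMap 0 1 θ :=
  continuous_circleMap 0 1

theorem measurable_radialLog (r : ℝ) (a : ℕ) : Measurable (radialLog r a) := by
  unfold radialLog
  refine Real.measurable_log.comp (Continuous.measurable ?_)
  have := continuous_circleMap_zero_one
  fun_prop

theorem hasSum_mul_prod {ι κ : Type*} {f : ι → ℂ} {g : κ → ℂ} {x y : ℂ}
    (hf : HasSum f x) (hg : HasSum g y) (hf' : Summable fun i => ‖f i‖)
    (hg' : Summable fun i => ‖g i‖) :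
    HasSum (fun q : ι × κ => f q.1 * g q.2) (x * y) :=
  HasSum.mul hf hg (summable_mul_of_summable_norm hf' hg')

theorem hasSum_mul_mul {ι κ μ : Type*} {f : ι → ℂ} {g : κ → ℂ} {h : μ → ℂ} {x y z : ℂ}
    (hf : HasSum f x) (hg : HasSum g y) (hh : HasSum h z) (hf' : Summable fun i => ‖f i‖)
    (hg' : Summable fun i => ‖g i‖) (hh' : Summable fun i => ‖h i‖) :
    HasSum (fun p : ι × κ × μ => f p.1 * (g p.2.1 * h p.2.2)) (x * (y * z)) := by
  obtain ⟨k, hk⟩ : ∃ k : κ × μ → ℂ, ∀ q, k q = g q.1 * h q.2 := ⟨_, fun _ => rfl⟩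
  have h1 := hasSum_mul_prod hg hh hg' hh'
  have h2 : Summable fun q : κ × μ => ‖g q.1 * h q.2‖ := Summable.mul_norm hg' hh'
  simp only [← hk] at h1 h2
  have h3 := hasSum_mul_prod hf h1 hf' h2
  simp only [hk] at h3
  exact h3

/-- The terms of the lattice sum attached to the Fourier coefficients of three logarithms. -/
noncomputable def latticeTerm (a b c : ℕ) (r : ℝ) (p : ℤ × ℤ × ℤ) : ℝ :=
  if a * p.1 + b * p.2.1 + c * p.2.2 = 0 then
    logCoeff r p.1 * (logCoeff r p.2.1 * logCoeff r p.2.2) else 0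

/-- For `r < 1` the triple product converges absolutely and uniformly in `θ`, so it may be
integrated termwise; orthogonality keeps exactly the frequencies equal to `0`. -/
theorem hasSum_latticeTerm_of_lt_one (a b c : ℕ) {r : ℝ} (hr : 0 ≤ r) (hr1 : r < 1) :
    HasSum (latticeTerm a b c r)
      (-8 * ((2 * Real.pi)⁻¹ *
        ∫ θ in 0..2 * Real.pi, radialLog r a θ * (radialLog r b θ * radialLog r c θ))) := by
  have hs := summable_logCoeff hr hr1
  have h0 : 0 ≤ logCoeff r := fun n => logCoeff_nonneg hr n
  have hs3 : Summable fun p : ℤ × ℤ × ℤ =>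
      logCoeff r p.1 * (logCoeff r p.2.1 * logCoeff r p.2.2) :=
    hs.mul_of_nonneg (hs.mul_of_nonneg hs h0 h0) h0 fun p => mul_nonneg (h0 _) (h0 _)
  have hnorm (n : ℤ) (θ : ℝ) (a : ℕ) :
      ‖(logCoeff r n : ℂ) * (circleMap 0 1 θ ^ a) ^ n‖ = logCoeff r n := by
    rw [norm_mul, norm_zpow, norm_pow, norm_circleMap_zero_one, one_pow, one_zpow, mul_one,
      Complex.norm_real, Real.norm_eq_abs, abs_of_nonneg (h0 n)]
  let F : ℤ × ℤ × ℤ → ℝ → ℂ := fun p θ =>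
    (logCoeff r p.1 * (circleMap 0 1 θ ^ a) ^ p.1) *
      ((logCoeff r p.2.1 * (circleMap 0 1 θ ^ b) ^ p.2.1) *
        (logCoeff r p.2.2 * (circleMap 0 1 θ ^ c) ^ p.2.2))
  have hF (p) (θ : ℝ) : F p θ = (logCoeff r p.1 * (logCoeff r p.2.1 * logCoeff r p.2.2) : ℝ) *
      circleMap 0 1 θ ^ (a * p.1 + b * p.2.1 + c * p.2.2) := by
    have hne : circleMap 0 1 θ ≠ 0 := by
      rw [← norm_ne_zero_iff, norm_circleMap_zero_one]
      exact one_ne_zero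
    simp only [F]
    rw [zpow_add₀ hne, zpow_add₀ hne, zpow_mul, zpow_mul, zpow_mul, zpow_natCast, zpow_natCast,
      zpow_natCast]
    push_cast
    ring
  have hsum (θ : ℝ) : HasSum (fun p => F p θ)
      ((-8 * (radialLog r a θ * (radialLog r b θ * radialLog r c θ)) : ℝ) : ℂ) := by
    have hA (a : ℕ) := hasSum_logCoeff_mul_zpow hr hr1 (y := circleMap 0 1 θ ^ a)
      (by rw [norm_pow, norm_circleMap_zero_one, one_pow])
    have hn (a : ℕ) : Summable fun n : ℤ => ‖(logCoeff r n : ℂ) * (circleMap 0 1 θ ^ a) ^ n‖ := by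
      simpa only [hnorm] using hs
    have h3 := hasSum_mul_mul (hA a) (hA b) (hA c) (hn a) (hn b) (hn c)
    have h4 : ((-8 * (radialLog r a θ * (radialLog r b θ * radialLog r c θ)) : ℝ) : ℂ) =
        ((-2 * radialLog r a θ : ℝ) : ℂ) *
          (((-2 * radialLog r b θ : ℝ) : ℂ) * ((-2 * radialLog r c θ : ℝ) : ℂ)) := by
      push_cast
      ring
    rw [h4]
    exact h3
  have hcont (p) : Continuous (F p) := by
    have := continuous_circleMap_zero_one
    simp_rw [F]
    have hz (a : ℕ) (n : ℤ) : Continuous fun θ : ℝ => (circleMap 0 1 θ ^ a) ^ n :=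
      (this.pow a).zpow₀ n fun θ => Or.inl (pow_ne_zero _ (by
        rw [← norm_ne_zero_iff, norm_circleMap_zero_one]
        exact one_ne_zero))
    exact (continuous_const.mul (hz _ _)).mul
      ((continuous_const.mul (hz _ _)).mul (continuous_const.mul (hz _ _)))
  have key := intervalIntegral.hasSum_integral_of_dominated_convergence
    (a := 0) (b := 2 * Real.pi) (μ := MeasureTheory.volume) (F := F)
    (fun p _ => logCoeff r p.1 * (logCoeff r p.2.1 * logCoeff r p.2.2))
    (fun p => (hcont p).aestronglyMeasurable)
    (fun p => Filter.Eventually.of_forall fun θ _ => by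
      simp only [F, norm_mul] at hnorm ⊢
      rw [hnorm, hnorm, hnorm])
    (Filter.Eventually.of_forall fun θ _ => hs3)
    intervalIntegrable_const
    (Filter.Eventually.of_forall fun θ _ => hsum θ)
  rw [intervalIntegral.integral_ofReal, intervalIntegral.integral_const_mul] at key
  simp_rw [hF, intervalIntegral.integral_const_mul, integral_circleMap_zpow] at key
  rw [← Complex.hasSum_ofReal]
  have hpi : (Real.pi : ℂ) ≠ 0 := by exact_mod_cast Real.pi_ne_zero
  have hval : ((-8 * ((2 * Real.pi)⁻¹ * ∫ θ in 0..2 * Real.pi,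
      radialLog r a θ * (radialLog r b θ * radialLog r c θ)) : ℝ) : ℂ) =
      (2 * (Real.pi : ℂ))⁻¹ * ((-8 * ∫ θ in 0..2 * Real.pi,
        radialLog r a θ * (radialLog r b θ * radialLog r c θ) : ℝ) : ℂ) := by
    push_cast
    ring
  rw [hval]
  refine Eq.subst (motive := fun f => HasSum f _) (funext fun p => ?_)
    (key.mul_left ((2 * (Real.pi : ℂ))⁻¹))
  unfold latticeTerm
  split_ifs
  · field_simp
  · simp

/-! ### An integrable majorant uniform in the radius -/

/-- Since `1 - r ≤ ‖1 - r y‖`, the triangle inequality gives `‖1 - y‖ ≤ 2 ‖1 - r y‖`. -/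
theorem log_norm_bound {y : ℂ} (hy : ‖y‖ = 1) (hy1 : y ≠ 1) {r : ℝ} (hr : 0 ≤ r) (hr1 : r ≤ 1) :
    |Real.log ‖1 - r * y‖| ≤ Real.log 2 + |Real.log ‖1 - y‖| := by
  have hpos : 0 < ‖1 - y‖ := norm_pos_iff.2 (sub_ne_zero.2 hy1.symm)
  have hry : ‖(r : ℂ) * y‖ = r := by
    rw [norm_mul, hy, mul_one, Complex.norm_real, Real.norm_eq_abs, abs_of_nonneg hr]
  have hlow : ‖1 - y‖ / 2 ≤ ‖1 - r * y‖ := by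
    have h1 : ‖1 - y‖ ≤ ‖1 - r * y‖ + (1 - r) := by
      have h2 : ‖((r : ℂ) - 1) * y‖ = 1 - r := by
        rw [norm_mul, hy, mul_one, ← Complex.ofReal_one, ← Complex.ofReal_sub, Complex.norm_real,
          Real.norm_eq_abs, abs_sub_comm, abs_of_nonneg (by linarith)]
      calc ‖1 - y‖ = ‖(1 - r * y) + (r - 1) * y‖ := by ring_nf
        _ ≤ _ := (norm_add_le _ _).trans_eq (by rw [h2])
    have h3 : 1 - r ≤ ‖1 - r * y‖ := by
      have := norm_sub_norm_le 1 ((r : ℂ) * y)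
      rwa [norm_one, hry] at this
    linarith
  have hup : ‖1 - r * y‖ ≤ 2 := by
    refine (norm_sub_le _ _).trans ?_
    rw [norm_one, hry]
    linarith
  have hpos' : 0 < ‖1 - r * y‖ := by linarith
  have h1 := Real.log_le_log (by positivity) hlow
  have h2 := Real.log_le_log hpos' hup
  rw [Real.log_div hpos.ne' two_ne_zero] at h1
  rw [abs_le]
  exact ⟨by linarith [neg_abs_le (Real.log ‖1 - y‖)], by linarith [abs_nonneg (Real.log ‖1 - y‖)]⟩

/-- The logarithm is `O(t ^ (-1/6))` near `0`, so its cube is dominated by the integrable `t ^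
(-1/2)`. The constant is not sharp. -/
theorem log_two_add_abs_log_pow_three_le {t : ℝ} (ht : 0 ≤ t) (ht2 : t ≤ 2) :
    (Real.log 2 + |Real.log t|) ^ 3 ≤ 1000 * (1 + t ^ (-(1 / 2) : ℝ)) := by
  have hl2 : Real.log 2 ≤ 1 := by linarith [Real.log_two_lt_d9]
  have hl0 : 0 ≤ Real.log 2 := Real.log_nonneg one_le_two
  have hsnn : 0 ≤ t ^ (-(1 / 2) : ℝ) := Real.rpow_nonneg ht _
  rcases ht.eq_or_lt with rfl | htpos
  · rw [Real.log_zero, abs_zero, add_zero]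
    have : Real.log 2 ^ 3 ≤ 1 := pow_le_one₀ hl0 hl2
    nlinarith
  rcases le_total t 1 with h1 | h1
  · set s := t ^ (-(1 / 6) : ℝ) with hs
    have hs3 : t ^ (-(1 / 2) : ℝ) = s ^ 3 := by
      rw [hs, ← Real.rpow_natCast, ← Real.rpow_mul ht]
      norm_num
    have hs0 : 0 < s := Real.rpow_pos_of_pos htpos _
    have hlog : |Real.log t| ≤ 6 * s := by
      have := (Real.abs_log_mul_self_rpow_lt t (1 / 6) htpos h1 (by norm_num)).le
      rw [abs_mul, abs_of_pos (Real.rpow_pos_of_pos htpos _)] at this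
      rw [hs, Real.rpow_neg ht, ← div_eq_mul_inv, le_div_iff₀ (Real.rpow_pos_of_pos htpos _)]
      linarith
    rw [hs3]
    calc (Real.log 2 + |Real.log t|) ^ 3 ≤ (1 + 6 * s) ^ 3 := by gcongr
      _ ≤ 1000 * (1 + s ^ 3) := by
        nlinarith [mul_nonneg hs0.le (sq_nonneg (s - 1)), sq_nonneg (s - 1), pow_pos hs0 3]
  · have : |Real.log t| ≤ 1 := by
      rw [abs_of_nonneg (Real.log_nonneg h1)]
      exact (Real.log_le_log htpos ht2).trans hl2
    have : (Real.log 2 + |Real.log t|) ^ 3 ≤ 2 ^ 3 := by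
      gcongr
      linarith
    nlinarith

/-- The majorant `log 2 + |log |1 - e^{iθ}||` of the radial logarithms. -/
noncomputable def logMajorant (θ : ℝ) : ℝ := Real.log 2 + |Real.log ‖1 - circleMap 0 1 θ‖|

theorem logMajorant_nonneg (θ : ℝ) : 0 ≤ logMajorant θ :=
  add_nonneg (Real.log_nonneg one_le_two) (abs_nonneg _)

theorem measurable_logMajorant : Measurable logMajorant := by
  unfold logMajorant
  refine measurable_const.add (Measurable.abs (Real.measurable_log.comp (Continuous.measurable ?_)))
  have := continuous_circleMap_zero_one
  fun_prop

theorem norm_one_sub_circleMap (θ : ℝ) : ‖1 - circleMap 0 1 θ‖ = 2 * |Real.sin (θ / 2)| := by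
  rw [norm_sub_rev, circleMap_zero, Complex.ofReal_one, one_mul, mul_comm,
    Complex.norm_exp_I_mul_ofReal_sub_one, norm_mul, Real.norm_eq_abs, Real.norm_eq_abs,
    abs_of_pos two_pos]

theorem intervalIntegrable_logMajorant_pow_three (u v : ℝ) :
    IntervalIntegrable (fun θ => logMajorant θ ^ 3) MeasureTheory.volume u v := by
  have hev (θ : ℝ) : logMajorant (-θ) = logMajorant θ := by
    unfold logMajorant
    rw [norm_one_sub_circleMap, norm_one_sub_circleMap, neg_div, Real.sin_neg, abs_neg]
  have hper : Function.Periodic (fun θ => logMajorant θ ^ 3) (2 * Real.pi) := by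
    intro θ
    simp only [logMajorant, periodic_circleMap 0 1 θ]
  have hpos : IntervalIntegrable (fun θ => logMajorant θ ^ 3) MeasureTheory.volume 0 Real.pi := by
    have hb : IntervalIntegrable
        (fun θ : ℝ => 1000 * (1 + (2 / Real.pi) ^ (-(1 / 2) : ℝ) * θ ^ (-(1 / 2) : ℝ)))
        MeasureTheory.volume 0 Real.pi :=
      (intervalIntegrable_const.add
        ((intervalIntegral.intervalIntegrable_rpow' (by norm_num)).const_mul _)).const_mul _
    refine hb.mono_fun' (measurable_logMajorant.pow_const 3).aestronglyMeasurable ?_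
    refine (MeasureTheory.ae_restrict_iff' measurableSet_uIoc).2
      (Filter.Eventually.of_forall fun θ hθ => ?_)
    rw [Set.uIoc_of_le Real.pi_pos.le] at hθ
    simp only
    rw [Real.norm_eq_abs, abs_of_nonneg (pow_nonneg (logMajorant_nonneg θ) 3)]
    have hn := norm_one_sub_circleMap θ
    -- Jordan's inequality bounds the distance to `1` below by a multiple of `θ` on `(0, π]`;
    -- evenness and periodicity do the rest.
    have hs := Real.mul_abs_le_abs_sin (x := θ / 2) (by
      rw [abs_of_pos (by linarith [hθ.1])]
      linarith [hθ.2])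
    rw [abs_of_pos (by linarith [hθ.1] : 0 < θ / 2)] at hs
    have hle : 2 / Real.pi * θ ≤ ‖1 - circleMap 0 1 θ‖ := by
      rw [hn]
      linarith
    have hp : 0 < 2 / Real.pi := by positivity
    refine (log_two_add_abs_log_pow_three_le (norm_nonneg _) ?_).trans ?_
    · rw [hn]
      linarith [Real.abs_sin_le_one (θ / 2)]
    · rw [← Real.mul_rpow hp.le hθ.1.le]
      gcongr 1000 * (1 + ?_)
      exact Real.rpow_le_rpow_of_nonpos (mul_pos hp hθ.1) hle (by norm_num)
  have hneg : IntervalIntegrable (fun θ => logMajorant θ ^ 3) MeasureTheory.volume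
      (-Real.pi) 0 := by
    have := (IntervalIntegrable.iff_comp_neg (by simp)).1 hpos
    simp only [hev, neg_zero] at this
    exact this.symm
  refine hper.intervalIntegrable Real.two_pi_pos.ne' (t := -Real.pi) ?_ u v
  rw [show -Real.pi + 2 * Real.pi = Real.pi by ring]
  exact hneg.trans hpos

theorem intervalIntegrable_logMajorant_mul_pow_three {a : ℕ} (ha : 0 < a) (u v : ℝ) :
    IntervalIntegrable (fun θ => logMajorant (a * θ) ^ 3) MeasureTheory.volume u v := by
  have ha0 : (a : ℝ) ≠ 0 := by positivity
  have := (intervalIntegrable_logMajorant_pow_three (a * u) (a * v)).comp_mul_left (c := (a : ℝ))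
  rwa [mul_div_cancel_left₀ _ ha0, mul_div_cancel_left₀ _ ha0] at this

theorem intervalIntegrable_logMajorant_mul {a b c : ℕ} (ha : 0 < a) (hb : 0 < b) (hc : 0 < c)
    (u v : ℝ) :
    IntervalIntegrable
      (fun θ => logMajorant (a * θ) * (logMajorant (b * θ) * logMajorant (c * θ)))
      MeasureTheory.volume u v := by
  have hm (a : ℕ) : Measurable fun θ : ℝ => logMajorant (a * θ) :=
    measurable_logMajorant.comp (measurable_const_mul _)
  refine (((intervalIntegrable_logMajorant_mul_pow_three ha u v).add
    (intervalIntegrable_logMajorant_mul_pow_three hb u v)).add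
    (intervalIntegrable_logMajorant_mul_pow_three hc u v)).mono_fun'
    ((hm a).mul ((hm b).mul (hm c))).aestronglyMeasurable
    (Filter.Eventually.of_forall fun θ => ?_)
  have h1 := logMajorant_nonneg (a * θ)
  have h2 := logMajorant_nonneg (b * θ)
  have h3 := logMajorant_nonneg (c * θ)
  simp only
  generalize logMajorant (a * θ) = x at *
  generalize logMajorant (b * θ) = y at *
  generalize logMajorant (c * θ) = z at *
  rw [Real.norm_eq_abs, abs_of_nonneg (by positivity)]
  -- `x³ + y³ + z³ - 3xyz` is half the product of `x + y + z` and the sum of squared differences.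
  have := mul_nonneg (add_nonneg (add_nonneg h1 h2) h3)
    (add_nonneg (add_nonneg (sq_nonneg (x - y)) (sq_nonneg (y - z))) (sq_nonneg (z - x)))
  have := mul_nonneg h1 (mul_nonneg h2 h3)
  nlinarith

theorem ae_circleMap_pow_ne_one {a : ℕ} (ha : 0 < a) :
    ∀ᵐ θ : ℝ, circleMap 0 1 θ ^ a ≠ 1 := by
  have hc : (Set.range fun n : ℤ => n * (2 * Real.pi) / a).Countable := Set.countable_range _
  filter_upwards [hc.ae_notMem MeasureTheory.volume] with θ hθ h
  rw [circleMap_zero_one_pow, circleMap_zero, Complex.ofReal_one, one_mul,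
    Complex.exp_eq_one_iff] at h
  obtain ⟨n, hn⟩ := h
  refine hθ ⟨n, ?_⟩
  have h2 : ((a * θ : ℝ) : ℂ) = ((n * (2 * Real.pi) : ℝ) : ℂ) := by
    refine mul_right_cancel₀ Complex.I_ne_zero ?_
    rw [hn]
    push_cast
    ring
  have h3 : a * θ = n * (2 * Real.pi) := by exact_mod_cast h2
  have ha0 : (a : ℝ) ≠ 0 := by positivity
  simp only
  rw [← h3]
  field_simp

theorem radialLog_bound {a : ℕ} {θ : ℝ} (h : circleMap 0 1 θ ^ a ≠ 1) {r : ℝ} (hr : 0 ≤ r)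
    (hr1 : r ≤ 1) : |radialLog r a θ| ≤ logMajorant (a * θ) := by
  unfold radialLog logMajorant
  rw [← circleMap_zero_one_pow]
  exact log_norm_bound (by rw [norm_pow, norm_circleMap_zero_one, one_pow]) h hr hr1

theorem radialLog_mul_bound {a b c : ℕ} {θ : ℝ} (h1 : circleMap 0 1 θ ^ a ≠ 1)
    (h2 : circleMap 0 1 θ ^ b ≠ 1) (h3 : circleMap 0 1 θ ^ c ≠ 1) {r : ℝ} (hr : 0 ≤ r)
    (hr1 : r ≤ 1) :
    ‖radialLog r a θ * (radialLog r b θ * radialLog r c θ)‖ ≤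
      logMajorant (a * θ) * (logMajorant (b * θ) * logMajorant (c * θ)) := by
  rw [norm_mul, norm_mul]
  exact mul_le_mul (radialLog_bound h1 hr hr1)
    (mul_le_mul (radialLog_bound h2 hr hr1) (radialLog_bound h3 hr hr1) (norm_nonneg _)
      (logMajorant_nonneg _)) (by positivity) (logMajorant_nonneg _)

theorem measurable_radialLog_mul (r : ℝ) (a b c : ℕ) :
    Measurable fun θ => radialLog r a θ * (radialLog r b θ * radialLog r c θ) :=
  (measurable_radialLog r a).mul ((measurable_radialLog r b).mul (measurable_radialLog r c))

theorem intervalIntegrable_radialLog_one {a b c : ℕ} (ha : 0 < a) (hb : 0 < b) (hc : 0 < c) :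
    IntervalIntegrable (fun θ => radialLog 1 a θ * (radialLog 1 b θ * radialLog 1 c θ))
      MeasureTheory.volume 0 (2 * Real.pi) := by
  refine (intervalIntegrable_logMajorant_mul ha hb hc _ _).mono_fun'
    (measurable_radialLog_mul 1 a b c).aestronglyMeasurable ?_
  filter_upwards [MeasureTheory.ae_restrict_of_ae (ae_circleMap_pow_ne_one ha),
    MeasureTheory.ae_restrict_of_ae (ae_circleMap_pow_ne_one hb),
    MeasureTheory.ae_restrict_of_ae (ae_circleMap_pow_ne_one hc)] with θ h1 h2 h3
  exact radialLog_mul_bound h1 h2 h3 zero_le_one le_rfl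

/-! ### Passage to the unit circle -/

section

open Filter Topology

theorem tendsto_integral_radialLog {a b c : ℕ} (ha : 0 < a) (hb : 0 < b) (hc : 0 < c) :
    Tendsto (fun r : ℝ =>
        ∫ θ in 0..2 * Real.pi, radialLog r a θ * (radialLog r b θ * radialLog r c θ))
      (𝓝[<] 1)
      (𝓝 (∫ θ in 0..2 * Real.pi, radialLog 1 a θ * (radialLog 1 b θ * radialLog 1 c θ))) := by
  have hev : ∀ᶠ r : ℝ in 𝓝[<] 1, 0 ≤ r ∧ r ≤ 1 := by
    filter_upwards [Ioo_mem_nhdsLT (show (0 : ℝ) < 1 by norm_num)] with r hr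
    exact ⟨hr.1.le, hr.2.le⟩
  refine intervalIntegral.tendsto_integral_filter_of_dominated_convergence
    (fun θ => logMajorant (a * θ) * (logMajorant (b * θ) * logMajorant (c * θ)))
    (Eventually.of_forall fun r => (measurable_radialLog_mul r a b c).aestronglyMeasurable)
    ?_ (intervalIntegrable_logMajorant_mul ha hb hc _ _) ?_
  · filter_upwards [hev] with r hr
    filter_upwards [ae_circleMap_pow_ne_one ha, ae_circleMap_pow_ne_one hb,
      ae_circleMap_pow_ne_one hc] with θ h1 h2 h3 _
    exact radialLog_mul_bound h1 h2 h3 hr.1 hr.2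
  · filter_upwards [ae_circleMap_pow_ne_one ha, ae_circleMap_pow_ne_one hb,
      ae_circleMap_pow_ne_one hc] with θ h1 h2 h3 _
    have hlim {a : ℕ} (h : circleMap 0 1 θ ^ a ≠ 1) :
        Tendsto (fun r : ℝ => radialLog r a θ) (𝓝[<] 1) (𝓝 (radialLog 1 a θ)) := by
      have hc : ContinuousAt (fun r : ℝ => radialLog r a θ) 1 := by
        unfold radialLog
        refine ContinuousAt.log (by fun_prop) ?_
        rw [norm_ne_zero_iff, sub_ne_zero, Complex.ofReal_one, one_mul]
        exact h.symm
      exact hc.tendsto.mono_left nhdsWithin_le_nhds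
    exact (hlim h1).mul ((hlim h2).mul (hlim h3))

theorem latticeTerm_nonneg (a b c : ℕ) {r : ℝ} (hr : 0 ≤ r) (p : ℤ × ℤ × ℤ) :
    0 ≤ latticeTerm a b c r p := by
  unfold latticeTerm
  split_ifs
  · exact mul_nonneg (logCoeff_nonneg hr _)
      (mul_nonneg (logCoeff_nonneg hr _) (logCoeff_nonneg hr _))
  · exact le_rfl

theorem latticeTerm_le_one (a b c : ℕ) {r : ℝ} (hr : 0 ≤ r) (hr1 : r ≤ 1) (p : ℤ × ℤ × ℤ) :
    latticeTerm a b c r p ≤ latticeTerm a b c 1 p := by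
  unfold latticeTerm
  split_ifs
  · exact mul_le_mul (logCoeff_le_one hr hr1 _)
      (mul_le_mul (logCoeff_le_one hr hr1 _) (logCoeff_le_one hr hr1 _) (logCoeff_nonneg hr _)
        (logCoeff_nonneg zero_le_one _))
      (mul_nonneg (logCoeff_nonneg hr _) (logCoeff_nonneg hr _)) (logCoeff_nonneg zero_le_one _)
  · exact le_rfl

theorem tendsto_latticeTerm (a b c : ℕ) (p : ℤ × ℤ × ℤ) :
    Tendsto (fun r => latticeTerm a b c r p) (𝓝[<] 1) (𝓝 (latticeTerm a b c 1 p)) := by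
  have : Continuous fun r => latticeTerm a b c r p := by
    unfold latticeTerm logCoeff
    split_ifs <;> fun_prop
  exact (this.tendsto 1).mono_left nhdsWithin_le_nhds

/-- The terms are nonnegative, so each finite sum at `r = 1` is bounded by the limit of the
integrals. This gives summability, and the terms at `r = 1` then dominate those at `r < 1`. -/
theorem hasSum_latticeTerm_one {a b c : ℕ} (ha : 0 < a) (hb : 0 < b) (hc : 0 < c) :
    HasSum (latticeTerm a b c 1)
      (-8 * ((2 * Real.pi)⁻¹ *
        ∫ θ in 0..2 * Real.pi, radialLog 1 a θ * (radialLog 1 b θ * radialLog 1 c θ))) := by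
  have hlim := ((tendsto_integral_radialLog ha hb hc).const_mul ((2 * Real.pi)⁻¹)).const_mul (-8)
  have hev : ∀ᶠ r : ℝ in 𝓝[<] 1, 0 ≤ r ∧ r < 1 := by
    filter_upwards [Ioo_mem_nhdsLT (show (0 : ℝ) < 1 by norm_num)] with r hr
    exact ⟨hr.1.le, hr.2⟩
  have hsum : Summable (latticeTerm a b c 1) := by
    refine summable_of_sum_le (fun p => latticeTerm_nonneg a b c zero_le_one p) fun u =>
      le_of_tendsto_of_tendsto
        (tendsto_finsetSum u fun p _ => tendsto_latticeTerm a b c p) hlim ?_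
    filter_upwards [hev] with r hr
    exact sum_le_hasSum u (fun p _ => latticeTerm_nonneg a b c hr.1 p)
      (hasSum_latticeTerm_of_lt_one a b c hr.1 hr.2)
  have h2 := tendsto_tsum_of_dominated_convergence hsum (tendsto_latticeTerm a b c)
    (by
      filter_upwards [hev] with r hr p
      rw [Real.norm_eq_abs, abs_of_nonneg (latticeTerm_nonneg a b c hr.1 p)]
      exact latticeTerm_le_one a b c hr.1 hr.2.le p)
  have h3 := tendsto_nhds_unique_of_eventuallyEq h2 hlim (by
    filter_upwards [hev] with r hr
    exact (hasSum_latticeTerm_of_lt_one a b c hr.1 hr.2).tsum_eq)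
  rw [← h3]
  exact hsum.hasSum

end

/-! ### Removal of absolute values and assembly -/

/-- Exactly one variable differs in sign from the other two. Two of the three terms are then `-1 /
|x y z|` and the third is `1 / |x y z|`. -/
theorem inv_sum_abs {x y z : ℝ} (hx : x ≠ 0) (hy : y ≠ 0) (hz : z ≠ 0) {a b c : ℝ}
    (ha : 0 < a) (hb : 0 < b) (hc : 0 < c) (h : a * x + b * y + c * z = 0) :
    1 / (|x| * y * z) + 1 / (|y| * z * x) + 1 / (|z| * x * y) = -(1 / (|x| * (|y| * |z|))) := by
  rcases lt_or_gt_of_ne hx with h1 | h1 <;> rcases lt_or_gt_of_ne hy with h2 | h2 <;>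
    rcases lt_or_gt_of_ne hz with h3 | h3 <;>
    first
    | (exfalso; nlinarith [mul_neg_of_pos_of_neg ha h1, mul_neg_of_pos_of_neg hb h2,
        mul_neg_of_pos_of_neg hc h3])
    | (exfalso; nlinarith [mul_pos ha h1, mul_pos hb h2, mul_pos hc h3])
    | (simp only [abs_of_pos, abs_of_neg, h1, h2, h3]
       field_simp
       norm_num)

theorem latticeTerm_one_eq {a b c : ℕ} (ha : 0 < a) (hb : 0 < b) (hc : 0 < c) (p : ℤ × ℤ × ℤ) :
    latticeTerm a b c 1 p =
      -((if a * p.1 + b * p.2.1 + c * p.2.2 = 0 then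
          1 / (|(p.1 : ℝ)| * p.2.1 * p.2.2) else 0) +
        (if a * p.1 + b * p.2.1 + c * p.2.2 = 0 then
          1 / (|(p.2.1 : ℝ)| * p.2.2 * p.1) else 0) +
        (if a * p.1 + b * p.2.1 + c * p.2.2 = 0 then
          1 / (|(p.2.2 : ℝ)| * p.1 * p.2.1) else 0)) := by
  obtain ⟨n, m, k⟩ := p
  unfold latticeTerm logCoeff
  simp only [one_pow]
  split_ifs with h
  · by_cases hn : n = 0
    · simp [hn]
    by_cases hm : m = 0
    · simp [hm]
    by_cases hk : k = 0
    · simp [hk]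
    rw [inv_sum_abs (Int.cast_ne_zero.2 hn) (Int.cast_ne_zero.2 hm) (Int.cast_ne_zero.2 hk)
      (Nat.cast_pos.2 ha) (Nat.cast_pos.2 hb) (Nat.cast_pos.2 hc) (by exact_mod_cast h), neg_neg]
    simp only [one_div, mul_inv]
  · simp

theorem hasSum_of_hasSum_latticeTerm {a b c : ℕ} (ha : 0 < a) (hb : 0 < b) (hc : 0 < c)
    (habc : Nat.gcd (Nat.gcd a b) c = 1) {S : ℝ} (hS : HasSum (latticeTerm a b c 1) S) :
    S / 4 = (a * b * c * (1 / (Nat.lcm a b : ℝ) ^ 3 + 1 / (Nat.lcm b c : ℝ) ^ 3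
          + 1 / (Nat.lcm c a : ℝ) ^ 3)) * ∑' n : ℕ, 1 / (n : ℝ) ^ 3
      - Real.pi / (2 * c * Nat.gcd a b) * ∑' h : ℕ, cotSeriesTerm a b c h
      - Real.pi / (2 * b * Nat.gcd a c) * ∑' h : ℕ, cotSeriesTerm a c b h
      - Real.pi / (2 * a * Nat.gcd b c) * ∑' h : ℕ, cotSeriesTerm b c a h
      - Real.pi / (2 * c * Nat.gcd b a) * ∑' h : ℕ, cotSeriesTerm b a c h
      - Real.pi / (2 * b * Nat.gcd c a) * ∑' h : ℕ, cotSeriesTerm c a b h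
      - Real.pi / (2 * a * Nat.gcd c b) * ∑' h : ℕ, cotSeriesTerm c b a h := by
  -- Each of the three signed families has the lattice terms as absolute values, hence is summable
  -- separately.
  have hbound (x y z : ℤ) (P : Prop) [Decidable P] :
      ‖(if P then 1 / (|(x : ℝ)| * y * z) else 0 : ℝ)‖ =
        if P then 1 / |(x : ℝ)| * (1 / |(y : ℝ)| * (1 / |(z : ℝ)|)) else 0 := by
    split_ifs
    · rw [norm_div, norm_mul, norm_mul, norm_one, Real.norm_eq_abs, Real.norm_eq_abs,
        Real.norm_eq_abs, abs_abs]
      simp only [one_div, mul_inv, mul_assoc]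
    · exact norm_zero
  have s1 : Summable fun p : ℤ × ℤ × ℤ => if a * p.1 + b * p.2.1 + c * p.2.2 = 0 then
      1 / (|(p.1 : ℝ)| * p.2.1 * p.2.2) else 0 := by
    refine Summable.of_norm (hS.summable.congr fun p => ?_)
    rw [hbound]
    simp only [latticeTerm, logCoeff, one_pow]
  have s2 : Summable fun p : ℤ × ℤ × ℤ => if a * p.1 + b * p.2.1 + c * p.2.2 = 0 then
      1 / (|(p.2.1 : ℝ)| * p.2.2 * p.1) else 0 := by
    refine Summable.of_norm (hS.summable.congr fun p => ?_)
    rw [hbound]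
    simp only [latticeTerm, logCoeff, one_pow]
    congr 1
    ring
  have s3 : Summable fun p : ℤ × ℤ × ℤ => if a * p.1 + b * p.2.1 + c * p.2.2 = 0 then
      1 / (|(p.2.2 : ℝ)| * p.1 * p.2.1) else 0 := by
    refine Summable.of_norm (hS.summable.congr fun p => ?_)
    rw [hbound]
    simp only [latticeTerm, logCoeff, one_pow]
    congr 1
    ring
  obtain ⟨S1, h1⟩ := s1
  obtain ⟨S2, h2⟩ := s2
  obtain ⟨S3, h3⟩ := s3
  have hsum : S = -(S1 + S2 + S3) := by
    refine hS.unique ?_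
    rw [funext (latticeTerm_one_eq ha hb hc)]
    exact ((h1.add h2).add h3).neg
  -- A cyclic relabelling reduces the other two sums to the first with `(b, c, a)` and `(c, a, b)`.
  let e : ℤ × ℤ × ℤ ≃ ℤ × ℤ × ℤ :=
    { toFun := fun p => (p.2.2, p.1, p.2.1)
      invFun := fun p => (p.2.1, p.2.2, p.1)
      left_inv := fun _ => rfl
      right_inv := fun _ => rfl }
  have t1 := tsum_lattice ha hb hc habc h1
  have t2 := tsum_lattice hb hc ha (S := S2)
    (by rw [Nat.gcd_comm, ← Nat.gcd_assoc, habc]) (by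
      rw [← e.symm.hasSum_iff]
      refine Eq.subst (motive := fun f => HasSum f _) (funext fun p => ?_) h2
      exact if_congr (by rw [add_rotate]; rfl) rfl rfl)
  have t3 := tsum_lattice hc ha hb (S := S3)
    (by rw [Nat.gcd_assoc, Nat.gcd_comm, habc]) (by
      rw [← e.hasSum_iff]
      refine Eq.subst (motive := fun f => HasSum f _) (funext fun p => ?_) h3
      exact if_congr (by rw [← add_rotate]; rfl) rfl rfl)
  rw [hsum, t1, t2, t3, Nat.gcd_comm b a, Nat.gcd_comm c a, Nat.gcd_comm c b, Nat.lcm_comm b a,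
    Nat.lcm_comm c b, Nat.lcm_comm a c]
  ring

theorem theorem4p3 (a b c : ℕ) (ha : 0 < a) (hb : 0 < b) (hc : 0 < c)
    (habc : Nat.gcd (Nat.gcd a b) c = 1) :
    CircleIntegrable (mahlerIntegrand ![X ^ a - 1, X ^ b - 1, X ^ c - 1]) 0 1 ∧
    Summable (cotSeriesTerm a b c) ∧ Summable (cotSeriesTerm a c b) ∧ Summable (cotSeriesTerm b c a) ∧
    Summable (cotSeriesTerm b a c) ∧ Summable (cotSeriesTerm c a b) ∧ Summable (cotSeriesTerm c b a) ∧
    ((-2 * multipleMahlerMeasure ![X ^ a - 1, X ^ b - 1, X ^ c - 1] : ℝ) : ℂ) =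
      ((a * b * c * (1 / (Nat.lcm a b : ℝ) ^ 3 + 1 / (Nat.lcm b c : ℝ) ^ 3
          + 1 / (Nat.lcm c a : ℝ) ^ 3) : ℝ) : ℂ) * riemannZeta 3
      - ((Real.pi / (2 * c * Nat.gcd a b) * ∑' h : ℕ, cotSeriesTerm a b c h : ℝ) : ℂ)
      - ((Real.pi / (2 * b * Nat.gcd a c) * ∑' h : ℕ, cotSeriesTerm a c b h : ℝ) : ℂ)
      - ((Real.pi / (2 * a * Nat.gcd b c) * ∑' h : ℕ, cotSeriesTerm b c a h : ℝ) : ℂ)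
      - ((Real.pi / (2 * c * Nat.gcd b a) * ∑' h : ℕ, cotSeriesTerm b a c h : ℝ) : ℂ)
      - ((Real.pi / (2 * b * Nat.gcd c a) * ∑' h : ℕ, cotSeriesTerm c a b h : ℝ) : ℂ)
      - ((Real.pi / (2 * a * Nat.gcd c b) * ∑' h : ℕ, cotSeriesTerm c b a h : ℝ) : ℂ) := by
  have hint (θ : ℝ) : mahlerIntegrand ![X ^ a - 1, X ^ b - 1, X ^ c - 1] (circleMap 0 1 θ) =
      radialLog 1 a θ * (radialLog 1 b θ * radialLog 1 c θ) := by
    have hl (a : ℕ) : radialLog 1 a θ = Real.log ‖circleMap 0 1 θ ^ a - 1‖ := by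
      rw [radialLog, norm_sub_rev, Complex.ofReal_one, one_mul]
    simp only [mahlerIntegrand, Fin.prod_univ_three, hl]
    simp [mul_assoc]
  refine ⟨?_, summable_cotSeriesTerm _ _ hb, summable_cotSeriesTerm _ _ hc,
    summable_cotSeriesTerm _ _ hc, summable_cotSeriesTerm _ _ ha, summable_cotSeriesTerm _ _ ha,
    summable_cotSeriesTerm _ _ hb, ?_⟩
  · rw [circleIntegrable_def]
    simp_rw [hint]
    exact intervalIntegrable_radialLog_one ha hb hc
  · have h := hasSum_of_hasSum_latticeTerm ha hb hc habc (hasSum_latticeTerm_one ha hb hc)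
    have hm : -2 * multipleMahlerMeasure ![X ^ a - 1, X ^ b - 1, X ^ c - 1] =
        -8 * ((2 * Real.pi)⁻¹ * ∫ θ in 0..2 * Real.pi,
          radialLog 1 a θ * (radialLog 1 b θ * radialLog 1 c θ)) / 4 := by
      rw [multipleMahlerMeasure, Real.circleAverage_def]
      simp_rw [hint]
      rw [smul_eq_mul]
      ring
    -- The sum may start at `n = 0`, where the term is `1 / 0 = 0`.
    have hz : riemannZeta 3 = ((∑' n : ℕ, 1 / (n : ℝ) ^ 3 : ℝ) : ℂ) := by
      have := zeta_nat_eq_tsum_of_gt_one (show 1 < 3 by norm_num)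
      push_cast at this ⊢
      exact this
    rw [hm, h, hz]
    push_cast
    ring
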